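/- Let $V$ be a complex vector space of dimension $n$ with a Hermitian inner product, and let $V^*$ be its complex dual, with the induced Hermitian inner products on the spaces $\bigwedge^{r,0}V^*=\bigwedge^r V^*$. Let $p,q\ge 0$ with $p+q=n$, and put $\sigma_r=2^{-r}(\sqrt{-1})^{r^2}$, $N=\binom{n}{q}$ and $k=(N-1)-pq$ (the codimension of the Plücker-embedded Grassmannian $G(q,n)$ in $\mathbb P^{N-1}$). A form $\Omega\in\bigwedge^{p,p}V^*$ is called transverse if for every nonzero decomposable $(q,0)$-form $\tau=\gamma_1\wedge\cdots\wedge\gamma_q$, $\gamma_i\in V^*$, the volume form $\Omega\wedge\sigma_q\,\tau\wedge\bar\tau$ is strictly positive, i.e. equal to $c\,\sigma_n\,\beta\wedge\bar\beta$ with $c>0$ and $0\neq\beta\in\bigwedge^{n,0}V^*$. A canonical form of $\Omega$ is an expression $\Omega=\sigma_p\sum_{j=1}^N\lambda_j\,\eta_j\wedge\bar\eta_j$ with $\lambda_j\in\mathbb R$ and $\{\eta_j\}$ an orthogonal basis of $\bigwedge^{p,0}V^*$ with $|\eta_j|^2=2^p$; the positive index of $\Omega$ is the number of $j$ with $\lambda_j>0$.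 Let $\Omega$ be a transverse $(p,p)$-form of $V^*$. Then $\Omega$ is real ($\bar\Omega=\Omega$), it has a canonical form, the number of positive $\lambda_j$ is the same in all its canonical forms, and this positive index of $\Omega$ is at least $N-k$. -/

import Mathlib

open Module

noncomputable section

namespace PQForm

section Semilinear

variable {M M' : Type*} [AddCommGroup M] [Module ℂ M] [AddCommGroup M'] [Module ℂ M']

theorem mapConj_aux (f : M →ₛₗ[starRingEnd ℂ] M') (c : ℂ) (x : M) :
    ExteriorAlgebra.ι ℂ (f (c • x)) =
      algebraMap ℂ (ExteriorAlgebra ℂ M') (starRingEnd ℂ c) * ExteriorAlgebra.ι ℂ (f x) := by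
  rw [f.map_smulₛₗ, LinearMap.map_smul, Algebra.smul_def]

/-- The ring homomorphism of exterior algebras induced by a conjugate-linear map `f`:
it sends `m₁ ∧ ⋯ ∧ m_r` to `f m₁ ∧ ⋯ ∧ f m_r` and a scalar `c` to its conjugate.
It is the usual extension by the universal property, where `ℂ` acts on the target through
complex conjugation. -/
def mapConj (f : M →ₛₗ[starRingEnd ℂ] M') :
    ExteriorAlgebra ℂ M →+* ExteriorAlgebra ℂ M' :=
  letI : Algebra ℂ (ExteriorAlgebra ℂ M') :=
    ((algebraMap ℂ (ExteriorAlgebra ℂ M')).comp (starRingEnd ℂ)).toAlgebra'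
      (fun c x => Algebra.commutes (starRingEnd ℂ c) x)
  (ExteriorAlgebra.lift ℂ
    ⟨{ toFun := fun m => ExteriorAlgebra.ι ℂ (f m)
       map_add' := fun x y => by simp
       map_smul' := fun c x => by
        have h := mapConj_aux f c x
        exact h },
      fun m => ExteriorAlgebra.ι_sq_zero (f m)⟩).toRingHom

@[simp]
theorem mapConj_ι (f : M →ₛₗ[starRingEnd ℂ] M') (m : M) :
    mapConj f (ExteriorAlgebra.ι ℂ m) = ExteriorAlgebra.ι ℂ (f m) := by
  let _ : Algebra ℂ (ExteriorAlgebra ℂ M') :=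
    ((algebraMap ℂ (ExteriorAlgebra ℂ M')).comp (starRingEnd ℂ)).toAlgebra'
      (fun c x => Algebra.commutes (starRingEnd ℂ c) x)
  exact ExteriorAlgebra.lift_ι_apply ℂ _ _ m

@[simp]
theorem mapConj_algebraMap (f : M →ₛₗ[starRingEnd ℂ] M') (c : ℂ) :
    mapConj f (algebraMap ℂ _ c) = algebraMap ℂ _ (starRingEnd ℂ c) := by
  let _ : Algebra ℂ (ExteriorAlgebra ℂ M') :=
    ((algebraMap ℂ (ExteriorAlgebra ℂ M')).comp (starRingEnd ℂ)).toAlgebra'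
      (fun c x => Algebra.commutes (starRingEnd ℂ c) x)
  exact AlgHom.commutes (ExteriorAlgebra.lift ℂ _) c

theorem mapConj_smul (f : M →ₛₗ[starRingEnd ℂ] M') (c : ℂ) (x : ExteriorAlgebra ℂ M) :
    mapConj f (c • x) = starRingEnd ℂ c • mapConj f x := by
  rw [Algebra.smul_def, map_mul, mapConj_algebraMap, ← Algebra.smul_def]

@[simp]
theorem mapConj_ιMulti (f : M →ₛₗ[starRingEnd ℂ] M') {r : ℕ} (v : Fin r → M) :
    mapConj f (ExteriorAlgebra.ιMulti ℂ r v) = ExteriorAlgebra.ιMulti ℂ r (fun i => f (v i)) := by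
  simp only [ExteriorAlgebra.ιMulti_apply, map_list_prod, List.map_ofFn]
  congr 2
  funext i
  exact mapConj_ι f (v i)

theorem mapConj_mem (f : M →ₛₗ[starRingEnd ℂ] M') {r : ℕ} {x : ExteriorAlgebra ℂ M}
    (hx : x ∈ ⋀[ℂ]^r M) : mapConj f x ∈ ⋀[ℂ]^r M' := by
  rw [← ExteriorAlgebra.ιMulti_span_fixedDegree] at hx
  induction hx using Submodule.span_induction with
  | mem x hx =>
    obtain ⟨v, rfl⟩ := hx
    rw [mapConj_ιMulti]
    exact ExteriorAlgebra.ιMulti_range ℂ r ⟨_, rfl⟩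
  | zero => simp
  | add x y _ _ hx hy => simpa using add_mem hx hy
  | smul c x _ hx =>
    rw [mapConj_smul]
    exact Submodule.smul_mem _ _ hx

end Semilinear

section Forms

variable (V : Type*) [AddCommGroup V] [Module ℂ V]

/-- The complexified exterior algebra of `V^*`: the exterior algebra over `ℂ` of the space of
complex-valued real-linear functionals on `V`, which is `V^* ⊕ conj(V^*)`.
The wedge product is the multiplication. -/
abbrev Forms : Type _ := ExteriorAlgebra ℂ (V →ₗ[ℝ] ℂ)

/-- Pointwise complex conjugation `γ ↦ (v ↦ conj (γ v))` of functionals. -/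
def conjCovec : (V →ₗ[ℝ] ℂ) →ₛₗ[starRingEnd ℂ] (V →ₗ[ℝ] ℂ) where
  toFun γ := Complex.conjAe.toLinearMap ∘ₗ γ
  map_add' _ _ := by ext; simp
  map_smul' _ _ := by ext; simp

variable {V}

/-- Complex conjugation of forms. -/
def conj : Forms V →+* Forms V := mapConj (conjCovec V)

/-- The inclusion of the exterior algebra of the complex dual `V^* = ⋀^{1,0}V^*` into the
complexified exterior algebra; it identifies `⋀^r V^*` with `⋀^{r,0}V^*`. -/
def hol : ExteriorAlgebra ℂ (Dual ℂ V) →ₐ[ℂ] Forms V :=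
  ExteriorAlgebra.map (LinearMap.restrictScalarsₗ ℝ ℂ V ℂ ℂ)

variable (V) in
/-- The space `⋀^{r,s}V^*` of `(r,s)`-forms, spanned by
`γ₁ ∧ ⋯ ∧ γ_r ∧ conj δ₁ ∧ ⋯ ∧ conj δ_s` with `γ_i, δ_j ∈ V^*`. -/
def formsOfType (r s : ℕ) : Submodule ℂ (Forms V) :=
  Submodule.span ℂ {ω | ∃ (γ : Fin r → Dual ℂ V) (δ : Fin s → Dual ℂ V),
    ω = hol (ExteriorAlgebra.ιMulti ℂ r γ) * conj (hol (ExteriorAlgebra.ιMulti ℂ s δ))}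

/-- The constant `σ_r = 2^{-r} (√-1)^{r²}`. -/
def sigma (r : ℕ) : ℂ := (2 : ℂ)⁻¹ ^ r * Complex.I ^ (r ^ 2)

open scoped ComplexOrder in
/-- A form `Θ` is a strictly positive `(r,r)`-form if
`Θ = σ_r ∑ A_{ij} β_i ∧ conj β_j` for a basis `β` of `⋀^{r,0}V^*` and a positive definite
Hermitian matrix `A` (whether such an `A` exists does not depend on the basis). -/
def IsStrictlyPositive (r : ℕ) (Θ : Forms V) : Prop :=
  ∃ (N : ℕ) (β : Basis (Fin N) ℂ (⋀[ℂ]^r (Dual ℂ V))) (A : Matrix (Fin N) (Fin N) ℂ),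
    A.PosDef ∧
      Θ = sigma r • ∑ i, ∑ j, A i j • (hol (β i : ExteriorAlgebra ℂ (Dual ℂ V)) *
        conj (hol (β j : ExteriorAlgebra ℂ (Dual ℂ V))))

/-- `Ξ` is a transverse `(p,p)`-form on a space of dimension `p + q`: it is of type `(p,p)`, and
the volume form `Ξ ∧ σ_q τ ∧ conj τ` is strictly positive for every nonzero decomposable
`(q,0)`-form `τ = γ₁ ∧ ⋯ ∧ γ_q`. -/
def IsTransverse (p q : ℕ) (Ξ : Forms V) : Prop :=
  Ξ ∈ formsOfType V p p ∧
    ∀ γ : Fin q → Dual ℂ V, ExteriorAlgebra.ιMulti ℂ q γ ≠ 0 →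
      IsStrictlyPositive (p + q)
        (Ξ * (sigma q • (hol (ExteriorAlgebra.ιMulti ℂ q γ) *
          conj (hol (ExteriorAlgebra.ιMulti ℂ q γ)))))

end Forms

section Hermitian

variable {V : Type*} [NormedAddCommGroup V] [InnerProductSpace ℂ V] [FiniteDimensional ℂ V]

variable (V) in
/-- The conjugate-linear Riesz map `V^* → V`, `γ = ⟪v, ·⟫ ↦ v`. -/
def sharp : Dual ℂ V →ₛₗ[starRingEnd ℂ] V :=
  haveI : CompleteSpace V := FiniteDimensional.complete ℂ V
  (InnerProductSpace.toDual ℂ V).symm.toLinearEquiv.toLinearMap.comp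
    (LinearMap.toContinuousLinearMap (𝕜 := ℂ) (E := V) (F' := ℂ)).toLinearMap

theorem inner_sharp (γ : Dual ℂ V) (v : V) : inner ℂ (sharp V γ) v = γ v := by
  have : CompleteSpace V := FiniteDimensional.complete ℂ V
  exact InnerProductSpace.toDual_symm_apply

/-- The Hermitian inner product on `⋀^p V^*` induced by the one of `V`, linear in `α`. -/
def formInner (p : ℕ) (α β : ⋀[ℂ]^p (Dual ℂ V)) : ℂ :=
  exteriorPower.pairingDual ℂ V p α ⟨mapConj (sharp V) β, mapConj_mem (sharp V) β.2⟩

/-- On decomposable elements `formInner` is the Gram determinant of the dual inner product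
`⟨γ, δ⟩ = ⟪sharp γ, sharp δ⟫` of `V^*`. -/
theorem formInner_ιMulti (p : ℕ) (γ δ : Fin p → Dual ℂ V) :
    formInner p (exteriorPower.ιMulti ℂ p γ) (exteriorPower.ιMulti ℂ p δ) =
      Matrix.det (Matrix.of fun i j => (inner ℂ (sharp V (γ i)) (sharp V (δ j)) : ℂ)) := by
  have h : (⟨mapConj (sharp V) (exteriorPower.ιMulti ℂ p δ),
      mapConj_mem (sharp V) (exteriorPower.ιMulti ℂ p δ).2⟩ : ⋀[ℂ]^p V) =
      exteriorPower.ιMulti ℂ p (fun j => sharp V (δ j)) := by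
    ext
    simp
  rw [formInner, h, exteriorPower.pairingDual_ιMulti_ιMulti, ← Matrix.det_transpose]
  congr 1
  ext i j
  simp [inner_sharp]

/-- `Ω = σ_p ∑ l_j η_j ∧ conj η_j` is a canonical form of the `(p,p)`-form `Ω`: the `l_j` are
real and `η` is an orthogonal basis of `⋀^{p,0}V^*` with `|η_j|² = 2^p`. -/
def IsCanonicalForm (p : ℕ) (Ω : Forms V) {N : ℕ} (l : Fin N → ℝ)
    (η : Basis (Fin N) ℂ (⋀[ℂ]^p (Dual ℂ V))) : Prop :=
  (∀ i j, i ≠ j → formInner p (η i) (η j) = 0) ∧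
  (∀ j, formInner p (η j) (η j) = 2 ^ p) ∧
  Ω = sigma p • ∑ j, (l j : ℂ) • (hol (η j : ExteriorAlgebra ℂ (Dual ℂ V)) *
    conj (hol (η j : ExteriorAlgebra ℂ (Dual ℂ V))))

/-- The number of positive coefficients `l_j`. -/
def numPos {N : ℕ} (l : Fin N → ℝ) : ℕ := Nat.card {j // 0 < l j}

/-- `m` is the positive index of `Ω`: the number of positive coefficients in a canonical form
of `Ω`. -/
def HasPositiveIndex (p : ℕ) (Ω : Forms V) (m : ℕ) : Prop :=
  ∃ (N : ℕ) (l : Fin N → ℝ) (η : Basis (Fin N) ℂ (⋀[ℂ]^p (Dual ℂ V))),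
    IsCanonicalForm p Ω l η ∧ numPos l = m

end Hermitian

end PQForm

end

/-!
The coefficients `C` of a `(p,p)`-form `Ω = σ_p ∑ C_{ij} e_i ∧ conj e_j` in a basis of `⋀^p V^*`
define a sesquilinear form `H(x, y) = ∑ C_{ij} [e_i ∧ x] conj [e_j ∧ y]` on `⋀^q V^*`, where `[·]`
is the coordinate on the line `⋀^{p+q} V^*`, and `Ω ∧ σ_q x ∧ conj x = H(x, x)` times a positive
volume form (`PQForm.IsTopCoord.ofMatrix_mul`). Transversality says that `H(τ, τ) > 0` for every
nonzero decomposable `τ`.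

*Reality and canonical forms.* The anti-Hermitian part of `H` vanishes at `(τ, τ)` for all
decomposable `τ`; polarizing in one factor of `τ` at a time shows that it vanishes on all pairs of
decomposable vectors, hence identically. So `C` is Hermitian, which gives `conj Ω = Ω`, and the
spectral theorem in an orthonormal basis of `⋀^p V^*` gives a canonical form.

*The positive index.* In a canonical form `H(x, x) = ∑ λ_j |[η_j ∧ x]|²`, and `x ↦ ([η_j ∧ x])_j`
is injective as the wedge pairing is nondegenerate. A dimension count as in Sylvester's law of
inertia shows that the number of positive `λ_j` does not depend on the canonical form.

*The lower bound.* If at most `pq` of the `λ_j` were positive, the corresponding linear forms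
`[η_j ∧ ·]` would have a common nonzero decomposable zero `τ`, because the Grassmannian has
dimension `pq`, and then `H(τ, τ) ≤ 0`. The existence of `τ`
(`exists_ιMulti_ne_zero_forall_eq_zero`) is a projective dimension theorem, proved as follows. The
homogeneous coordinate ring `B` of the Grassmannian is realized as the algebra generated by the
`T · m_I(a)`, for `m_I` the maximal minors of the matrix `(1 | a)`; it contains `T` and all
`a_{ij} T`, so it has transcendence degree `pq + 1`. By Cramer's rule, every point at which the
relations between the `T · m_I` hold consists of the minors of some matrix. If `r` linear forms had
no common zero besides the origin, the Nullstellensatz would make `B` integral over the subalgebra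
that they generate, so `r ≥ pq + 1`.
-/

/-! ### Linear sections of projective varieties with a rational parametrization -/

open MvPolynomial in
/-- The algebra map `y_s ↦ m_s T` to a polynomial ring in an extra variable `T`. Its image is the
homogeneous coordinate ring of the closure of the image of the projective map
`a ↦ [m_s(a)]_s`. -/
noncomputable def coneMap {k σ τ : Type*} [Field k] (m : σ → MvPolynomial τ k) :
    MvPolynomial σ k →ₐ[k] Polynomial (MvPolynomial τ k) :=
  aeval fun s => Polynomial.C (m s) * Polynomial.X

namespace coneMap

open MvPolynomial

variable {k σ τ : Type*} [Field k] (m : σ → MvPolynomial τ k)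

@[simp]
theorem apply_X (s : σ) : coneMap m (X s) = Polynomial.C (m s) * Polynomial.X := by
  simp [coneMap]

theorem apply_monomial (d : σ →₀ ℕ) (c : k) :
    coneMap m (monomial d c) = Polynomial.C (aeval m (monomial d c)) * Polynomial.X ^ d.degree := by
  rw [coneMap, aeval_monomial, aeval_monomial, Finsupp.prod, Finsupp.prod, Finsupp.degree_apply,
    ← Finset.prod_pow_eq_pow_sum, map_mul, map_prod, mul_assoc, ← Finset.prod_mul_distrib]
  simp only [mul_pow, map_pow]
  rfl

theorem apply_of_isHomogeneous {d : ℕ} {f : MvPolynomial σ k} (hf : f.IsHomogeneous d) :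
    coneMap m f = Polynomial.C (aeval m f) * Polynomial.X ^ d := by
  have h : ∀ e ∈ f.support, coneMap m (monomial e (coeff e f)) =
      Polynomial.C (aeval m (monomial e (coeff e f))) * Polynomial.X ^ d := by
    intro e he
    rw [apply_monomial]
    congr 2
    by_contra hne
    exact (mem_support_iff.mp he) (hf.coeff_eq_zero hne)
  rw [f.as_sum, map_sum, map_sum, map_sum, Finset.sum_mul]
  exact Finset.sum_congr rfl h

theorem coeff_apply (d : ℕ) (f : MvPolynomial σ k) :
    (coneMap m f).coeff d = aeval m (homogeneousComponent d f) := by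
  induction f using MvPolynomial.induction_on' with
  | monomial e c =>
    rw [apply_monomial, Polynomial.coeff_C_mul, Polynomial.coeff_X_pow]
    split_ifs with h
    · rw [mul_one, homogeneousComponent_of_mem (isHomogeneous_monomial c h.symm), if_pos rfl]
    · rw [mul_zero, homogeneousComponent_of_mem (isHomogeneous_monomial c rfl), if_neg h, map_zero]
  | add p q hp hq => simp [hp, hq]

/-- If the polynomials `l_j` have no common zero in the cone of `m` other than the origin, all
monomials of large degree are combinations of the `l_j`, modulo the relations of the cone. -/
theorem exists_degree_bound [IsAlgClosed k] [Finite σ] {ι : Type*} [Fintype ι]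
    (l : ι → MvPolynomial σ k)
    (h : ∀ y : σ → k, (∀ g, coneMap m g = 0 → eval y g = 0) → (∀ j, eval y (l j) = 0) → y = 0) :
    ∃ D : ℕ, ∀ e : σ →₀ ℕ, D < e.degree →
      ∃ r : ι → MvPolynomial σ k, coneMap m (monomial e 1) = ∑ j, coneMap m (r j * l j) := by
  classical
  have := Fintype.ofFinite σ
  let J : Ideal (MvPolynomial σ k) := RingHom.ker (coneMap m) ⊔ Ideal.span (Set.range l)
  have hX : ∀ s : σ, ∃ n : ℕ, (X s : MvPolynomial σ k) ^ n ∈ J := by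
    intro s
    have : (X s : MvPolynomial σ k) ∈ J.radical := by
      rw [← vanishingIdeal_zeroLocus_eq_radical (K := k) J]
      intro y hy
      have hy0 : y = 0 := by
        refine h y (fun g hg => ?_) (fun j => ?_)
        · exact hy g (Ideal.mem_sup_left hg)
        · exact hy _ (Ideal.mem_sup_right (Ideal.subset_span ⟨j, rfl⟩))
      simp [hy0]
    exact this
  choose n hn using hX
  refine ⟨∑ s, n s, fun e he => ?_⟩
  obtain ⟨s, hs⟩ : ∃ s, n s ≤ e s := by
    by_contra! hlt
    have : e.degree ≤ ∑ s, n s := by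
      rw [Finsupp.degree_eq_sum]
      exact Finset.sum_le_sum fun s _ => (hlt s).le
    omega
  have hmem : monomial e (1 : k) ∈ J := by
    have : monomial e (1 : k) = monomial (e - Finsupp.single s (n s)) 1 * X s ^ n s := by
      rw [X_pow_eq_monomial, monomial_mul, one_mul, tsub_add_cancel_of_le]
      simpa using hs
    rw [this]
    exact Ideal.mul_mem_left _ _ (hn s)
  obtain ⟨g, hg, x, hx, hgx⟩ := Submodule.mem_sup.mp hmem
  obtain ⟨r, rfl⟩ := Ideal.mem_span_range_iff_exists_fun.mp hx
  refine ⟨r, ?_⟩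
  rw [← hgx, map_add, RingHom.mem_ker.mp hg, zero_add, map_sum]

/-- A system of linear forms without common zeros in the projective variety of `m` makes its
homogeneous coordinate ring integral over the subalgebra the forms generate. -/
theorem isIntegral_of_forall_eq_zero [IsAlgClosed k] [Finite σ] {ι : Type*} [Fintype ι]
    (l : ι → MvPolynomial σ k) (hl : ∀ j, (l j).IsHomogeneous 1)
    (h : ∀ y : σ → k, (∀ g, coneMap m g = 0 → eval y g = 0) → (∀ j, eval y (l j) = 0) → y = 0)
    (f : MvPolynomial σ k) :
    IsIntegral (Algebra.adjoin k (Set.range fun j => coneMap m (l j))) (coneMap m f) := by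
  classical
  obtain ⟨D, hD⟩ := exists_degree_bound m l h
  set S := Algebra.adjoin k (Set.range fun j => coneMap m (l j)) with hS
  have hlS : ∀ j, coneMap m (l j) ∈ S := fun j => Algebra.subset_adjoin ⟨j, rfl⟩
  let T : Set (Polynomial (MvPolynomial τ k)) :=
    (fun e => coneMap m (monomial e 1)) '' {e : σ →₀ ℕ | e.degree ≤ D}
  have hT : T.Finite := (Finsupp.finite_of_degree_le D).image _
  let N : Submodule S (Polynomial (MvPolynomial τ k)) := Submodule.span S T
  have hk : ∀ (c : k) {x}, x ∈ N → c • x ∈ N := fun c x hx => by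
    rw [← algebraMap_smul S c x]
    exact N.smul_mem _ hx
  -- Induction on the degree: components of degree `d - 1` of the cofactors of `l j` suffice.
  have hmono : ∀ d : ℕ, ∀ e : σ →₀ ℕ, e.degree = d → coneMap m (monomial e 1) ∈ N := by
    intro d
    induction d using Nat.strong_induction_on with
    | _ d ih =>
      intro e he
      rcases le_or_gt d D with hd | hd
      · exact Submodule.subset_span ⟨e, by simp [he, hd], rfl⟩
      obtain ⟨r, hr⟩ := hD e (by omega)
      obtain ⟨d, rfl⟩ : ∃ d', d = d' + 1 := ⟨d - 1, by omega⟩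
      have hhom : ∀ p : MvPolynomial σ k, p.IsHomogeneous d → coneMap m p ∈ N := by
        intro p hp
        rw [p.as_sum, map_sum]
        refine N.sum_mem fun e' he' => ?_
        have : monomial e' (coeff e' p) = coeff e' p • monomial e' (1 : k) := by
          rw [smul_monomial, smul_eq_mul, mul_one]
        rw [this, map_smul]
        refine hk _ (ih d (by omega) e' ?_)
        by_contra hne
        exact (mem_support_iff.mp he') (hp.coeff_eq_zero hne)
      have key : coneMap m (monomial e 1) =
          ∑ j, coneMap m (l j) * coneMap m (homogeneousComponent d (r j)) := by
        have hc := congrArg (fun P => P.coeff (d + 1)) hr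
        simp only [Polynomial.finsetSum_coeff, map_mul, apply_monomial, he,
          apply_of_isHomogeneous m (hl _), Polynomial.coeff_C_mul, Polynomial.coeff_X_pow,
          if_true, mul_one, pow_one, ← mul_assoc, Polynomial.coeff_mul_X,
          Polynomial.coeff_mul_C, coeff_apply] at hc
        rw [apply_monomial, he, hc, map_sum, Finset.sum_mul]
        refine Finset.sum_congr rfl fun j _ => ?_
        rw [apply_of_isHomogeneous m (hl j),
          apply_of_isHomogeneous m (homogeneousComponent_isHomogeneous d (r j)), map_mul]
        ring
      rw [key]
      refine N.sum_mem fun j _ => ?_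
      exact N.smul_mem (⟨_, hlS j⟩ : S) (hhom _ (homogeneousComponent_isHomogeneous d (r j)))
  have hmem : ∀ p, coneMap m p ∈ N := by
    intro p
    rw [p.as_sum, map_sum]
    refine N.sum_mem fun e he => ?_
    have : monomial e (coeff e p) = coeff e p • monomial e (1 : k) := by
      rw [smul_monomial, smul_eq_mul, mul_one]
    rw [this, map_smul]
    exact hk _ (hmono _ e rfl)
  refine isIntegral_of_smul_mem_submodule N ?_ ⟨hT.toFinset, by simp [N]⟩ _ fun x hx => ?_
  · intro hbot
    have := hmem 1
    rw [hbot, map_one] at this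
    exact one_ne_zero ((Submodule.mem_bot S).mp this)
  · induction hx using Submodule.span_induction with
    | mem x hx =>
      obtain ⟨e, -, rfl⟩ := hx
      rw [smul_eq_mul, ← map_mul]
      exact hmem _
    | zero => simp
    | add x y _ _ hx hy => rw [smul_add]; exact N.add_mem hx hy
    | smul c x _ hx => rw [smul_comm]; exact N.smul_mem c hx

end coneMap

open MvPolynomial in
/-- A form of the projective dimension theorem: if the homogeneous coordinate ring of the
variety of `m` has the same transcendence degree as the ambient polynomial ring, that is
`#τ + 1`, then any `r ≤ #τ` linear forms have a common zero on the variety. -/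
theorem exists_ne_zero_forall_eval_eq_zero {k : Type} {σ τ : Type} [Field k] [IsAlgClosed k]
    [Finite σ] [Fintype τ] (m : σ → MvPolynomial τ k)
    (halg : ∀ S : Subalgebra k (Polynomial (MvPolynomial τ k)),
      (∀ s, IsAlgebraic S (coneMap m (X s))) →
        Algebra.IsAlgebraic S (Polynomial (MvPolynomial τ k)))
    {r : ℕ} (hr : r ≤ Fintype.card τ) (l : Fin r → MvPolynomial σ k)
    (hl : ∀ j, (l j).IsHomogeneous 1) :
    ∃ y : σ → k, y ≠ 0 ∧ (∀ g, coneMap m g = 0 → eval y g = 0) ∧ ∀ j, eval y (l j) = 0 := by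
  by_contra! hcon
  have h : ∀ y : σ → k, (∀ g, coneMap m g = 0 → eval y g = 0) → (∀ j, eval y (l j) = 0) →
      y = 0 := by
    intro y h1 h2
    by_contra hy
    obtain ⟨j, hj⟩ := hcon y hy h1
    exact hj (h2 j)
  have := halg _ fun s => (coneMap.isIntegral_of_forall_eq_zero m l hl h (X s)).isAlgebraic
  have h1 := Algebra.IsAlgebraic.trdeg_le_cardinalMk k
    (Set.range fun j => coneMap m (l j))
  have h2 := trdeg_add_eq k (MvPolynomial τ k)
    (A := Polynomial (MvPolynomial τ k))
  rw [Polynomial.trdeg_of_isDomain, MvPolynomial.trdeg_of_isDomain] at h2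
  rw [← h2] at h1
  have h3 := h1.trans Cardinal.mk_range_le
  simp at h3
  omega

/-! ### Linear sections of the Grassmannian -/

namespace Matrix

/-- The maximal minor of `B` on the columns `f 0, …, f (q - 1)`. -/
def maxMinor {R κ : Type*} [CommRing R] {q : ℕ} (B : Matrix (Fin q) κ R) (f : Fin q → κ) : R :=
  (B.submatrix id f).det

section

variable {R κ : Type*} [CommRing R] {q : ℕ} (B : Matrix (Fin q) κ R)

theorem maxMinor_update (f : Fin q → κ) (i : Fin q) (c : κ) :
    B.maxMinor (Function.update f i c) = (B.submatrix id f).cramer (fun i' => B i' c) i := by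
  rw [cramer_apply, maxMinor]
  congr 1
  ext i' j
  rcases eq_or_ne j i with rfl | h
  · simp
  · simp [h]

/-- By Cramer's rule, the maximal minors that differ from a given one in a single column
determine all the others. -/
theorem det_maxMinor_update_mul (f g : Fin q → κ) :
    (of fun i j => B.maxMinor (Function.update f i (g j))).det * B.maxMinor f =
      B.maxMinor f ^ q * B.maxMinor g := by
  have h : (of fun i j => B.maxMinor (Function.update f i (g j))) =
      (B.submatrix id f).adjugate * B.submatrix id g := by
    ext i j
    rw [of_apply, maxMinor_update, cramer_eq_adjugate_mulVec]
    rfl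
  rw [h, det_mul, mul_right_comm, maxMinor, ← det_mul, adjugate_mul, det_smul, det_one, mul_one,
    Fintype.card_fin, maxMinor]

end

/-- The generic matrix `(1 | a)` of the standard affine chart of the Grassmannian. -/
noncomputable def chart (k : Type) [Field k] (q p : ℕ) :
    Matrix (Fin q) (Fin q ⊕ Fin p) (MvPolynomial (Fin q × Fin p) k) :=
  of fun i => Sum.elim (fun j => (1 : Matrix (Fin q) (Fin q) _) i j)
    (fun j => MvPolynomial.X (i, j))

theorem chart_submatrix_inl (k : Type) [Field k] (q p : ℕ) :
    (chart k q p).submatrix id Sum.inl = 1 := by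
  ext i j
  simp [chart]

/-- The cone over the Grassmannian has dimension `pq + 1`: its coordinate ring contains `T` and
all `a_{ij} T`. -/
theorem isAlgebraic_of_isAlgebraic_coneMap_chart {k : Type} [Field k] {q p : ℕ}
    (S : Subalgebra k (Polynomial (MvPolynomial (Fin q × Fin p) k)))
    (hS : ∀ f, IsAlgebraic S (coneMap (chart k q p).maxMinor (MvPolynomial.X f))) :
    Algebra.IsAlgebraic S (Polynomial (MvPolynomial (Fin q × Fin p) k)) := by
  classical
  simp only [coneMap.apply_X] at hS
  have hT : IsAlgebraic S (Polynomial.X : Polynomial (MvPolynomial (Fin q × Fin p) k)) := by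
    simpa [maxMinor, chart_submatrix_inl] using hS Sum.inl
  have ha : ∀ ij : Fin q × Fin p, IsAlgebraic S
      (Polynomial.C (MvPolynomial.X ij) : Polynomial (MvPolynomial (Fin q × Fin p) k)) := by
    rintro ⟨i, j⟩
    have h := hS (Function.update Sum.inl i (Sum.inr j))
    rw [maxMinor_update, chart_submatrix_inl, cramer_one, mul_comm] at h
    exact IsAlgebraic.of_mul (mem_nonZeroDivisors_of_ne_zero Polynomial.X_ne_zero) hT
      (by simpa [chart] using h)
  refine ⟨fun x => ?_⟩
  change x ∈ Subalgebra.algebraicClosure S _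
  induction x using Polynomial.induction_on' with
  | add p q hp hq => exact add_mem hp hq
  | monomial n c =>
    rw [← Polynomial.C_mul_X_pow_eq_monomial]
    refine mul_mem ?_ (pow_mem hT n)
    induction c using MvPolynomial.induction_on with
    | C c =>
      exact (isAlgebraic_algebraMap (R := S) (algebraMap k S c))
    | add p q hp hq => rw [map_add]; exact add_mem hp hq
    | mul_X p ij hp => rw [map_mul]; exact mul_mem hp (ha ij)

/-- The Grassmannian of `q`-dimensional subspaces of `k^{p+q}`, in its Plücker embedding, meets
every linear subspace of codimension at most `pq`. -/
theorem exists_maxMinor_ne_zero_forall_sum_eq_zero {k : Type} [Field k] [IsAlgClosed k]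
    {q p r : ℕ} (hr : r ≤ q * p) (c : Fin r → (Fin q → Fin q ⊕ Fin p) → k) :
    ∃ A : Matrix (Fin q) (Fin q ⊕ Fin p) k, (∃ f, A.maxMinor f ≠ 0) ∧
      ∀ j, ∑ f, c j f * A.maxMinor f = 0 := by
  classical
  obtain ⟨y, hy0, hy, hyl⟩ := exists_ne_zero_forall_eval_eq_zero (chart k q p).maxMinor
    isAlgebraic_of_isAlgebraic_coneMap_chart (r := r) (by simpa using hr)
    (fun j => ∑ f, MvPolynomial.C (c j f) * MvPolynomial.X f)
    (fun j => MvPolynomial.IsHomogeneous.sum _ _ _ fun f _ => by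
      simpa using (MvPolynomial.isHomogeneous_C _ (c j f)).mul (MvPolynomial.isHomogeneous_X k f))
  obtain ⟨f₀, hf₀⟩ : ∃ f₀, y f₀ ≠ 0 := by
    by_contra! h
    exact hy0 (funext h)
  have hrel : ∀ f, (of fun i j => y (Function.update f₀ i (f j))).det * y f₀ =
      y f₀ ^ q * y f := by
    intro f
    have h := hy ((of fun i j => MvPolynomial.X (Function.update f₀ i (f j))).det *
      MvPolynomial.X f₀ - MvPolynomial.X f₀ ^ q * MvPolynomial.X f) ?_
    · rw [map_sub, map_mul, map_mul, map_pow, RingHom.map_det, sub_eq_zero] at h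
      simpa [RingHom.mapMatrix_apply, Matrix.map] using h
    · rw [map_sub, map_mul, map_mul, map_pow, AlgHom.map_det, sub_eq_zero]
      have hdet : (coneMap (chart k q p).maxMinor).mapMatrix
          (of fun i j => MvPolynomial.X (Function.update f₀ i (f j))) =
          (Polynomial.X : Polynomial (MvPolynomial (Fin q × Fin p) k)) •
            Polynomial.C.mapMatrix
              (of fun i j => (chart k q p).maxMinor (Function.update f₀ i (f j))) := by
        ext1 i j
        simp
      rw [hdet, det_smul, ← RingHom.map_det, coneMap.apply_X, coneMap.apply_X, Fintype.card_fin]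
      have h := congrArg Polynomial.C (det_maxMinor_update_mul (chart k q p) f₀ f)
      rw [map_mul, map_mul, map_pow] at h
      linear_combination Polynomial.X ^ (q + 1) * h
  have hA : ∀ f, (of fun i j => (y f₀)⁻¹ * y (Function.update f₀ i j)).maxMinor f =
      (y f₀)⁻¹ * y f := by
    intro f
    have h1 : (of fun i j => (y f₀)⁻¹ * y (Function.update f₀ i j)).submatrix id f =
        (y f₀)⁻¹ • of fun i j => y (Function.update f₀ i (f j)) := by
      ext i j
      simp
    rw [maxMinor, h1, det_smul, Fintype.card_fin, inv_pow]
    have := hrel f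
    field_simp
    linear_combination this
  refine ⟨of fun i j => (y f₀)⁻¹ * y (Function.update f₀ i j), ⟨f₀, ?_⟩, fun j => ?_⟩
  · rw [hA, inv_mul_cancel₀ hf₀]
    exact one_ne_zero
  · have h := hyl j
    simp only [map_sum, map_mul, MvPolynomial.eval_C, MvPolynomial.eval_X] at h
    simp only [hA, mul_left_comm _ (y f₀)⁻¹, ← Finset.mul_sum, h, mul_zero]

end Matrix

/-- Expansion of an alternating map along a family, as a sum of minors over all (not necessarily
increasing) sequences of indices; each minor is counted once for every ordering. -/
theorem AlternatingMap.factorial_smul_apply_sum {R M N κ : Type*} [CommRing R] [AddCommGroup M]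
    [Module R M] [AddCommGroup N] [Module R N] [Fintype κ] {q : ℕ} (L : M [⋀^Fin q]→ₗ[R] N)
    (A : Matrix (Fin q) κ R) (b : κ → M) :
    q.factorial • L (fun i => ∑ j, A i j • b j) =
      ∑ f : Fin q → κ, A.maxMinor f • L (b ∘ f) := by
  classical
  have hL : L (fun i => ∑ j, A i j • b j) = ∑ f : Fin q → κ, (∏ i, A i (f i)) • L (b ∘ f) := by
    rw [← AlternatingMap.coe_multilinearMap, MultilinearMap.map_sum]
    refine Finset.sum_congr rfl fun f _ => ?_
    rw [MultilinearMap.map_smul_univ]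
    rfl
  have hperm : ∀ s : Equiv.Perm (Fin q),
      ∑ f : Fin q → κ, (Equiv.Perm.sign s • ∏ i, A (s i) (f i)) • L (b ∘ f) =
        L (fun i => ∑ j, A i j • b j) := by
    intro s
    rw [hL, ← (Equiv.arrowCongr s (Equiv.refl κ)).symm.sum_comp]
    refine Finset.sum_congr rfl fun f _ => ?_
    have h1 : b ∘ ((Equiv.arrowCongr s (Equiv.refl κ)).symm f) = (b ∘ f) ∘ s := by
      ext i; simp
    rw [h1, AlternatingMap.map_perm, ← Equiv.prod_comp s (fun i => A i (f i))]
    simp only [Equiv.arrowCongr_symm, Equiv.refl_symm, Equiv.arrowCongr_apply, Equiv.coe_refl,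
      Function.comp_apply, Equiv.symm_symm, id]
    rcases Int.units_eq_one_or (Equiv.Perm.sign s) with h | h <;> simp [h]
  simp only [Matrix.maxMinor, Matrix.det_apply, Matrix.submatrix_apply, id, Finset.sum_smul]
  rw [Finset.sum_comm, Finset.sum_congr rfl fun s _ => hperm s, Finset.sum_const,
    Finset.card_univ, Fintype.card_perm, Fintype.card_fin]

/-- On a space of dimension `p + q`, any `r ≤ pq` alternating `q`-forms have a common zero among
the linearly independent `q`-tuples, i.e. their linear extensions to `⋀^q` have a common nonzero
decomposable zero. -/
theorem exists_ιMulti_ne_zero_forall_eq_zero {k : Type} {E : Type*} [Field k] [IsAlgClosed k]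
    [CharZero k] [AddCommGroup E] [Module k E] [FiniteDimensional k E] {p q r : ℕ}
    (hE : finrank k E = p + q) (hr : r ≤ q * p) (L : Fin r → E [⋀^Fin q]→ₗ[k] k) :
    ∃ γ : Fin q → E, ExteriorAlgebra.ιMulti k q γ ≠ 0 ∧ ∀ j, L j γ = 0 := by
  classical
  let b : Basis (Fin q ⊕ Fin p) k E :=
    (finBasisOfFinrankEq k E hE).reindex ((finCongr (add_comm p q)).trans finSumFinEquiv.symm)
  obtain ⟨A, ⟨f, hf⟩, hA⟩ := Matrix.exists_maxMinor_ne_zero_forall_sum_eq_zero hr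
    (fun j f => L j (b ∘ f))
  refine ⟨fun i => ∑ j, A i j • b j, fun h => hf ?_, fun j => ?_⟩
  · -- The minor of `A` on the columns `f` is an alternating map evaluated at the rows of `A`.
    have h1 := exteriorPower.pairingDual_ιMulti_ιMulti (R := k) (fun i => b.coord (f i))
      (fun i => ∑ j, A i j • b j)
    have h2 : exteriorPower.ιMulti k q (fun i => ∑ j, A i j • b j) = 0 := Subtype.ext h
    rw [h2, map_zero] at h1
    rw [h1, Matrix.maxMinor]
    congr 1
    ext i j
    exact (congrFun (b.repr_sum_self (A i)) (f j)).symm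
  · have h := (L j).factorial_smul_apply_sum A b
    have h0 : ∑ f : Fin q → Fin q ⊕ Fin p, A.maxMinor f • L j (b ∘ f) = 0 := by
      rw [← hA j]
      exact Finset.sum_congr rfl fun f _ => mul_comm _ _
    rw [h0, nsmul_eq_mul] at h
    exact (mul_eq_zero.mp h).resolve_left (Nat.cast_ne_zero.mpr q.factorial_ne_zero)

/-! ### Exterior powers and polarization -/

namespace ExteriorAlgebra

section CommRing

variable {R M : Type*} [CommRing R] [AddCommGroup M] [Module R M]

theorem ιMulti_mem (r : ℕ) (v : Fin r → M) : ιMulti R r v ∈ ⋀[R]^r M :=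
  ιMulti_range R r ⟨v, rfl⟩

theorem ι_mul_ιMulti (x : M) {b : ℕ} (v : Fin b → M) :
    ι R x * ιMulti R b v = (-1 : R) ^ b • (ιMulti R b v * ι R x) := by
  induction b with
  | zero => simp [ιMulti_zero_apply]
  | succ b ih =>
    rw [ιMulti_succ_apply, ← mul_assoc, eq_neg_of_add_eq_zero_left (ι_add_mul_swap x (v 0)),
      neg_mul, mul_assoc, ih, mul_smul_comm, pow_succ, mul_neg_one, neg_smul, mul_assoc]

/-- The exterior product is graded-commutative. -/
theorem mul_eq_neg_one_pow_smul_mul {a b : ℕ} {x y : ExteriorAlgebra R M} (hx : x ∈ ⋀[R]^a M)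
    (hy : y ∈ ⋀[R]^b M) : x * y = (-1 : R) ^ (a * b) • (y * x) := by
  rw [← ιMulti_span_fixedDegree] at hx hy
  induction hx using Submodule.span_induction with
  | zero => simp
  | add x x' _ _ hx hx' => rw [add_mul, mul_add, smul_add, hx, hx']
  | smul c x _ hx => rw [smul_mul_assoc, mul_smul_comm, hx, smul_comm]
  | mem x hx =>
    obtain ⟨v, rfl⟩ := hx
    induction hy using Submodule.span_induction with
    | zero => simp
    | add y y' _ _ hy hy' => rw [add_mul, mul_add, smul_add, hy, hy']
    | smul c y _ hy => rw [smul_mul_assoc, mul_smul_comm, hy, smul_comm]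
    | mem y hy =>
      obtain ⟨w, rfl⟩ := hy
      induction a with
      | zero => simp [ιMulti_zero_apply]
      | succ a ih =>
        rw [ιMulti_succ_apply, mul_assoc, ih, mul_smul_comm, ← mul_assoc, ι_mul_ιMulti,
          smul_mul_assoc, smul_smul, mul_assoc, ← pow_add]
        congr 2
        ring

end CommRing

section Field

variable {K E : Type*} [Field K] [AddCommGroup E] [Module K E]

theorem ιMulti_ne_zero_of_linearIndependent {r : ℕ} {v : Fin r → E}
    (hv : LinearIndependent K v) : ιMulti K r v ≠ 0 := by
  have h := (exteriorPower.ιMulti_family_linearIndependent_field (n := r) hv).ne_zero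
    (Set.powersetCard.ofFinEmbEquiv (RelEmbedding.refl _))
  intro h0
  refine h (Subtype.ext ?_)
  rw [exteriorPower.ιMulti_family_apply_coe]
  simpa [ιMulti_family] using h0

/-- The product of two complementary elements of the standard bases of `⋀^p E` and `⋀^q E` spans
the top exterior power. -/
theorem ιMulti_family_mul_compl_ne_zero {p q n : ℕ} (b : Basis (Fin n) K E)
    (s : Set.powersetCard (Fin n) p) (t : Set.powersetCard (Fin n) q)
    (h : Disjoint (s : Finset (Fin n)) (t : Finset (Fin n))) :
    ιMulti_family K p b s * ιMulti_family K q b t ≠ 0 := by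
  rw [ιMulti_family_mul_of_disjoint K b s t h]
  have h0 := (exteriorPower.ιMulti_family_linearIndependent_field (n := p + q)
    b.linearIndependent).ne_zero (Set.powersetCard.disjUnion h)
  have h1 : ιMulti_family K (p + q) b (Set.powersetCard.disjUnion h) ≠ 0 := fun h' =>
    h0 (Subtype.ext (by rw [exteriorPower.ιMulti_family_apply_coe, h']; rfl))
  rcases Int.units_eq_one_or (Equiv.Perm.sign (Set.powersetCard.permOfDisjoint h)) with h2 | h2
  · simpa [h2] using h1
  · simpa [h2] using h1

theorem ιMulti_family_mul_ιMulti_family_eq_zero {p q n : ℕ} (hn : p + q = n)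
    (b : Basis (Fin n) K E) (s : Set.powersetCard (Fin n) p) (t : Set.powersetCard (Fin n) q)
    (h : Set.powersetCard.compl (by simpa using hn) t ≠ s) :
    ιMulti_family K p b s * ιMulti_family K q b t = 0 := by
  refine ιMulti_family_mul_of_not_disjoint K b s t fun hd => h ?_
  symm
  rw [Set.powersetCard.eq_iff_subset, Set.powersetCard.coe_compl]
  exact Finset.subset_compl_iff_disjoint_right.mpr hd

variable [FiniteDimensional K E]

/-- In top degree the exterior power is a line, spanned by the product of a basis. -/
theorem exists_eq_smul_ιMulti {n : ℕ} (hn : finrank K E = n) (b : Basis (Fin n) K E) :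
    ∃ φ : ExteriorAlgebra K E →ₗ[K] K, ∀ x ∈ ⋀[K]^n E, x = φ x • ιMulti K n b := by
  have hb : ιMulti K n b ≠ 0 := ιMulti_ne_zero_of_linearIndependent b.linearIndependent
  obtain ⟨f, hf, -⟩ := Submodule.exists_le_ker_of_notMem (p := ⊥)
    (fun h => hb ((Submodule.mem_bot K).mp h))
  refine ⟨(f (ιMulti K n b))⁻¹ • f, fun x hx => ?_⟩
  have h1 : finrank K (⋀[K]^n E) = 1 := by rw [exteriorPower.finrank_eq, hn, Nat.choose_self]
  obtain ⟨c, hc⟩ := (finrank_eq_one_iff_of_nonzero'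
    (⟨ιMulti K n b, ιMulti_mem n b⟩ : ⋀[K]^n E) (fun h => hb (congrArg Subtype.val h))).mp h1
      ⟨x, hx⟩
  have hc : c • ιMulti K n b = x := congrArg Subtype.val hc
  rw [← hc, map_smul, LinearMap.smul_apply, smul_eq_mul, smul_eq_mul, inv_mul_cancel₀ hf, mul_one]

/-- The pairing `⋀^p E × ⋀^q E → ⋀^{p+q} E` is nondegenerate when `dim E = p + q`. -/
theorem eq_zero_of_forall_mul_eq_zero {p q : ℕ} (hn : finrank K E = p + q)
    {x : ExteriorAlgebra K E} (hx : x ∈ ⋀[K]^q E) (h : ∀ y ∈ ⋀[K]^p E, y * x = 0) : x = 0 := by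
  let b : Basis (Fin (p + q)) K E := finBasisOfFinrankEq K E hn
  have hrepr := (b.exteriorPower q).sum_repr ⟨x, hx⟩
  have hzero : ∀ t, (b.exteriorPower q).repr ⟨x, hx⟩ t = 0 := by
    intro t
    let s : Set.powersetCard (Fin (p + q)) p := Set.powersetCard.compl (by simp) t
    have hs := h _ (exteriorPower.ιMulti_family K p b s).2
    have hx' : x = ∑ t, (b.exteriorPower q).repr ⟨x, hx⟩ t • ιMulti_family K q b t := by
      conv_lhs => rw [show x = ((⟨x, hx⟩ : ⋀[K]^q E) : ExteriorAlgebra K E) from rfl, ← hrepr]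
      simp
    rw [hx', Finset.mul_sum, Finset.sum_eq_single t, mul_smul_comm,
      exteriorPower.ιMulti_family_apply_coe] at hs
    · refine (smul_eq_zero.mp hs).resolve_right (ιMulti_family_mul_compl_ne_zero b s t ?_)
      exact Finset.subset_compl_iff_disjoint_right.mp subset_rfl
    · intro t' _ ht'
      rw [mul_smul_comm, exteriorPower.ιMulti_family_apply_coe,
        ιMulti_family_mul_ιMulti_family_eq_zero rfl b s t', smul_zero]
      exact fun h => ht' ((Set.powersetCard.compl _).injective h)
    · simp
  have : (⟨x, hx⟩ : ⋀[K]^q E) = 0 := by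
    rw [← hrepr]
    simp [hzero]
  exact congrArg Subtype.val this

end Field

end ExteriorAlgebra

/-- Polarization on decomposable vectors: a sesquilinear form that vanishes on the diagonal of the
image of a multilinear map vanishes on all pairs of vectors of that image. The slots are made
independent one at a time. -/
theorem LinearMap.eq_zero_of_forall_multilinear_self_eq_zero {E M : Type*} [AddCommGroup E]
    [Module ℂ E] [AddCommGroup M] [Module ℂ M] {q : ℕ}
    (m : MultilinearMap ℂ (fun _ : Fin q => E) M) (d : M →ₗ[ℂ] M →ₛₗ[starRingEnd ℂ] ℂ)
    (h : ∀ v, d (m v) (m v) = 0) (v w : Fin q → E) : d (m v) (m w) = 0 := by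
  classical
  have key : ∀ s : Finset (Fin q), ∀ v w : Fin q → E, (∀ i ∉ s, v i = w i) →
      d (m v) (m w) = 0 := by
    intro s
    induction s using Finset.induction_on with
    | empty =>
      intro v w hvw
      obtain rfl : v = w := funext fun i => hvw i (by simp)
      exact h v
    | insert i s hi ih =>
      intro v w hvw
      have hdiag : ∀ a : E, d (m (Function.update v i a)) (m (Function.update w i a)) = 0 := by
        intro a
        refine ih _ _ fun j hj => ?_
        rcases eq_or_ne j i with rfl | hji
        · simp
        · simp [hji, hvw j (by simp [hji, hj])]
      have hswap : ∀ a b : E, d (m (Function.update v i a)) (m (Function.update w i b)) +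
          d (m (Function.update v i b)) (m (Function.update w i a)) = 0 := by
        intro a b
        have := hdiag (a + b)
        simp only [MultilinearMap.map_update_add, map_add, LinearMap.add_apply, hdiag] at this
        linear_combination this
      have h1 := hswap (v i) (w i)
      have h2 := hswap (Complex.I • v i) (w i)
      simp only [MultilinearMap.map_update_smul, map_smul, LinearMap.smul_apply,
        LinearMap.map_smulₛₗ, Complex.conj_I, smul_eq_mul, Function.update_eq_self] at h1 h2
      linear_combination h1 / 2 - Complex.I / 2 * h2 + (d (m v) (m w) -
        d (m (Function.update v i (w i))) (m (Function.update w i (v i)))) / 2 * Complex.I_sq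
  exact key Finset.univ v w (by simp)

/-! ### Forms of type `(p,p)` and their sesquilinear forms -/

namespace PQForm

open scoped Matrix

section

variable {V : Type*} [AddCommGroup V] [Module ℂ V]

theorem hol_mem {r : ℕ} {x : ExteriorAlgebra ℂ (Dual ℂ V)} (hx : x ∈ ⋀[ℂ]^r (Dual ℂ V)) :
    (hol x : Forms V) ∈ ⋀[ℂ]^r (V →ₗ[ℝ] ℂ) := by
  rw [← ExteriorAlgebra.ιMulti_span_fixedDegree] at hx
  induction hx using Submodule.span_induction with
  | mem x hx =>
    obtain ⟨v, rfl⟩ := hx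
    rw [hol, ExteriorAlgebra.map_apply_ιMulti]
    exact ExteriorAlgebra.ιMulti_mem r _
  | zero => simp
  | add x y _ _ hx hy => rw [map_add]; exact add_mem hx hy
  | smul c x _ hx => rw [map_smul]; exact Submodule.smul_mem _ _ hx

theorem conj_mem {r : ℕ} {x : Forms V} (hx : x ∈ ⋀[ℂ]^r (V →ₗ[ℝ] ℂ)) :
    conj x ∈ ⋀[ℂ]^r (V →ₗ[ℝ] ℂ) :=
  mapConj_mem _ hx

theorem conj_smul (c : ℂ) (x : Forms V) : conj (c • x) = starRingEnd ℂ c • conj x :=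
  mapConj_smul _ c x

theorem conj_conj (x : Forms V) : conj (conj x) = x := by
  induction x using ExteriorAlgebra.induction with
  | algebraMap r => simp [conj]
  | ι m =>
    simp only [conj, mapConj_ι]
    congr 1
    ext v
    simp [conjCovec]
  | mul a b ha hb => rw [map_mul, map_mul, ha, hb]
  | add a b ha hb => rw [map_add, map_add, ha, hb]

theorem sigma_ne_zero (r : ℕ) : sigma r ≠ 0 := by simp [sigma]

/-- The sign from reordering factors is absorbed by the constants `σ_r`. -/
theorem sigma_mul_sigma (p q : ℕ) : sigma p * sigma q * (-1) ^ (p * q) = sigma (p + q) := by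
  rw [sigma, sigma, sigma, ← Complex.I_sq]
  ring

theorem conj_sigma (p : ℕ) : starRingEnd ℂ (sigma p) * (-1) ^ (p * p) = sigma p := by
  rw [sigma, map_mul, map_pow, map_pow, Complex.conj_I, map_inv₀, Complex.conj_ofNat, mul_assoc,
    ← sq p, ← mul_pow]
  simp

/-- The `(p,p)`-form `σ_p ∑ C_{ij} v_i ∧ conj v_j`. -/
noncomputable def ofMatrix {ι : Type*} [Fintype ι] (p : ℕ) (v : ι → ExteriorAlgebra ℂ (Dual ℂ V))
    (C : Matrix ι ι ℂ) : Forms V :=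
  sigma p • ∑ i, ∑ j, C i j • (hol (v i) * conj (hol (v j)))

theorem conj_ofMatrix {ι : Type*} [Fintype ι] {p : ℕ} {v : ι → ExteriorAlgebra ℂ (Dual ℂ V)}
    (hv : ∀ i, v i ∈ ⋀[ℂ]^p (Dual ℂ V)) (C : Matrix ι ι ℂ) :
    conj (ofMatrix p v C) = ofMatrix p v Cᴴ := by
  have h : ∀ i j, conj (C i j • (hol (v i) * conj (hol (v j)))) =
      (-1 : ℂ) ^ (p * p) • (Cᴴ j i • (hol (v j) * conj (hol (v i)))) := by
    intro i j
    rw [conj_smul, map_mul, conj_conj,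
      ExteriorAlgebra.mul_eq_neg_one_pow_smul_mul (conj_mem (hol_mem (hv i))) (hol_mem (hv j)),
      smul_comm]
    rfl
  rw [ofMatrix, conj_smul, map_sum]
  simp only [map_sum, h, ← Finset.smul_sum]
  rw [smul_smul, conj_sigma, Finset.sum_comm]
  rfl

theorem ofMatrix_diagonal {ι : Type*} [Fintype ι] [DecidableEq ι] (p : ℕ)
    (v : ι → ExteriorAlgebra ℂ (Dual ℂ V)) (d : ι → ℂ) :
    ofMatrix p v (Matrix.diagonal d) = sigma p • ∑ j, d j • (hol (v j) * conj (hol (v j))) := by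
  rw [ofMatrix]
  congr 1
  refine Finset.sum_congr rfl fun i _ => ?_
  rw [Finset.sum_eq_single i]
  · simp
  · intro j _ hj
    simp [Matrix.diagonal_apply_ne' _ hj]
  · simp

/-- Change of the spanning family: `v ↦ ∑ v_i U_{i•}` transforms the coefficients by
`C ↦ U C Uᴴ`. -/
theorem ofMatrix_sum_smul {ι κ : Type*} [Fintype ι] [Fintype κ] (p : ℕ)
    (v : ι → ExteriorAlgebra ℂ (Dual ℂ V)) (U : Matrix ι κ ℂ) (C : Matrix κ κ ℂ) :
    ofMatrix p (fun a => ∑ i, U i a • v i) C = ofMatrix p v (U * C * Uᴴ) := by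
  have h : ∀ a b, C a b • (hol (∑ i, U i a • v i) * conj (hol (∑ i, U i b • v i))) =
      ∑ i, ∑ j, (U i a * C a b * Uᴴ b j) • (hol (v i) * conj (hol (v j))) := by
    intro a b
    simp only [map_sum, map_smul, conj_smul, Finset.sum_mul_sum, Finset.smul_sum,
      smul_mul_smul_comm, smul_smul]
    refine Finset.sum_congr rfl fun i _ => Finset.sum_congr rfl fun j _ => ?_
    congr 1
    rw [Matrix.conjTranspose_apply, ← starRingEnd_apply]
    ring
  rw [ofMatrix, ofMatrix]
  congr 1
  simp only [h, Matrix.mul_apply, Finset.sum_mul, Finset.sum_smul]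
  rw [Finset.sum_congr rfl fun a _ => Finset.sum_comm, Finset.sum_comm]
  refine Finset.sum_congr rfl fun i _ => ?_
  rw [Finset.sum_congr rfl fun a _ => Finset.sum_comm, Finset.sum_comm]
  refine Finset.sum_congr rfl fun j _ => ?_
  rw [Finset.sum_comm]

/-- Every form of type `(p,p)` has coefficients in a given basis of `⋀^p V^*`; their uniqueness is
not needed. -/
theorem exists_eq_ofMatrix {ι : Type*} [Fintype ι] {p : ℕ}
    (e : Basis ι ℂ (⋀[ℂ]^p (Dual ℂ V))) {Ω : Forms V} (hΩ : Ω ∈ formsOfType V p p) :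
    ∃ C : Matrix ι ι ℂ, Ω = ofMatrix p (fun i => (e i : ExteriorAlgebra ℂ (Dual ℂ V))) C := by
  have hexp : ∀ x ∈ ⋀[ℂ]^p (Dual ℂ V), ∃ a : ι → ℂ, x = ∑ i, a i • (e i : ExteriorAlgebra ℂ _) := by
    intro x hx
    refine ⟨e.repr ⟨x, hx⟩, ?_⟩
    have h := congrArg (Submodule.subtype _) (e.sum_repr ⟨x, hx⟩)
    rw [map_sum] at h
    exact h.symm
  induction hΩ using Submodule.span_induction with
  | mem x hx =>
    obtain ⟨γ, δ, rfl⟩ := hx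
    obtain ⟨a, ha⟩ := hexp _ (ExteriorAlgebra.ιMulti_mem p γ)
    obtain ⟨d, hd⟩ := hexp _ (ExteriorAlgebra.ιMulti_mem p δ)
    refine ⟨Matrix.of fun i j => (sigma p)⁻¹ * (a i * starRingEnd ℂ (d j)), ?_⟩
    rw [ha, hd, ofMatrix]
    simp only [map_sum, map_smul, conj_smul, Finset.sum_mul_sum, Finset.smul_sum,
      smul_mul_smul_comm, Matrix.of_apply, smul_smul, mul_inv_cancel_left₀ (sigma_ne_zero p)]
  | zero => exact ⟨0, by simp [ofMatrix]⟩
  | add x y _ _ hx hy =>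
    obtain ⟨C, rfl⟩ := hx
    obtain ⟨D, rfl⟩ := hy
    exact ⟨C + D, by simp [ofMatrix, add_smul, Finset.sum_add_distrib]⟩
  | smul c x _ hx =>
    obtain ⟨C, rfl⟩ := hx
    refine ⟨c • C, ?_⟩
    rw [ofMatrix, ofMatrix, smul_comm]
    simp [Finset.smul_sum, smul_smul]

/-- The sesquilinear form `(x, y) ↦ ∑ C_{ij} φ(v_i ∧ x) conj φ(v_j ∧ y)` on the exterior algebra.
When `φ` is the coordinate on `⋀^n V^*`, it is, up to a constant factor, the sesquilinear form
`(x, y) ↦ Ω ∧ x ∧ conj y` of `Ω = σ_p ∑ C_{ij} v_i ∧ conj v_j`. -/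
noncomputable def hermForm {ι : Type*} [Fintype ι] (φ : ExteriorAlgebra ℂ (Dual ℂ V) →ₗ[ℂ] ℂ)
    (v : ι → ExteriorAlgebra ℂ (Dual ℂ V)) (C : Matrix ι ι ℂ) :
    ExteriorAlgebra ℂ (Dual ℂ V) →ₗ[ℂ] ExteriorAlgebra ℂ (Dual ℂ V) →ₛₗ[starRingEnd ℂ] ℂ :=
  LinearMap.mk₂'ₛₗ (RingHom.id ℂ) (starRingEnd ℂ)
    (fun x y => ∑ i, ∑ j, C i j * (φ (v i * x) * starRingEnd ℂ (φ (v j * y))))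
    (fun x x' y => by simp only [mul_add, map_add, add_mul, Finset.sum_add_distrib])
    (fun c x y => by
      simp only [mul_smul_comm, map_smul, smul_eq_mul, Finset.mul_sum, RingHom.id_apply]
      exact Finset.sum_congr rfl fun i _ => Finset.sum_congr rfl fun j _ => by ring)
    (fun x y y' => by simp only [mul_add, map_add, Finset.sum_add_distrib])
    (fun c x y => by
      simp only [mul_smul_comm, map_smul, map_mul, smul_eq_mul, Finset.mul_sum]
      exact Finset.sum_congr rfl fun i _ => Finset.sum_congr rfl fun j _ => by ring)

theorem hermForm_apply {ι : Type*} [Fintype ι] (φ : ExteriorAlgebra ℂ (Dual ℂ V) →ₗ[ℂ] ℂ)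
    (v : ι → ExteriorAlgebra ℂ (Dual ℂ V)) (C : Matrix ι ι ℂ)
    (x y : ExteriorAlgebra ℂ (Dual ℂ V)) :
    hermForm φ v C x y =
      ∑ i, ∑ j, C i j * (φ (v i * x) * starRingEnd ℂ (φ (v j * y))) := rfl

theorem hermForm_conjTranspose {ι : Type*} [Fintype ι]
    (φ : ExteriorAlgebra ℂ (Dual ℂ V) →ₗ[ℂ] ℂ) (v : ι → ExteriorAlgebra ℂ (Dual ℂ V))
    (C : Matrix ι ι ℂ) (x y : ExteriorAlgebra ℂ (Dual ℂ V)) :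
    hermForm φ v Cᴴ x y = starRingEnd ℂ (hermForm φ v C y x) := by
  simp only [hermForm_apply, map_sum, map_mul, Complex.conj_conj, Matrix.conjTranspose_apply]
  rw [Finset.sum_comm]
  exact Finset.sum_congr rfl fun i _ => Finset.sum_congr rfl fun j _ => by
    rw [← starRingEnd_apply]; ring

theorem hermForm_diagonal {ι : Type*} [Fintype ι] [DecidableEq ι]
    (φ : ExteriorAlgebra ℂ (Dual ℂ V) →ₗ[ℂ] ℂ) (v : ι → ExteriorAlgebra ℂ (Dual ℂ V))
    (l : ι → ℝ) (x : ExteriorAlgebra ℂ (Dual ℂ V)) :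
    hermForm φ v (Matrix.diagonal fun i => (l i : ℂ)) x x =
      ((∑ i, l i * Complex.normSq (φ (v i * x)) : ℝ) : ℂ) := by
  rw [hermForm_apply, Complex.ofReal_sum]
  refine Finset.sum_congr rfl fun i _ => ?_
  rw [Finset.sum_eq_single i]
  · rw [Matrix.diagonal_apply_eq, Complex.mul_conj, Complex.ofReal_mul]
  · intro j _ hj
    rw [Matrix.diagonal_apply_ne' _ hj, zero_mul]
  · simp

/-- Moving `conj a'` past `x` produces the sign `(-1)^{pq}`. -/
theorem hol_mul_conj_hol_mul {p q : ℕ} {a a' x x' : ExteriorAlgebra ℂ (Dual ℂ V)}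
    (ha' : a' ∈ ⋀[ℂ]^p (Dual ℂ V)) (hx : x ∈ ⋀[ℂ]^q (Dual ℂ V)) :
    (hol a * conj (hol a')) * (hol x * conj (hol x')) =
      (-1 : ℂ) ^ (p * q) • (hol (a * x) * conj (hol (a' * x')) : Forms V) := by
  rw [mul_assoc, ← mul_assoc (conj (hol a')),
    ExteriorAlgebra.mul_eq_neg_one_pow_smul_mul (conj_mem (hol_mem ha')) (hol_mem hx),
    smul_mul_assoc, mul_smul_comm, map_mul, map_mul, map_mul]
  simp only [mul_assoc]

/-- `φ` is the coordinate of top degree forms with respect to `β`. -/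
noncomputable def IsTopCoord (n : ℕ) (β : ExteriorAlgebra ℂ (Dual ℂ V))
    (φ : ExteriorAlgebra ℂ (Dual ℂ V) →ₗ[ℂ] ℂ) : Prop :=
  ∀ x ∈ ⋀[ℂ]^n (Dual ℂ V), x = φ x • β

/-- The volume form `Ω ∧ σ_q x ∧ conj x` is the value at `(x, x)` of the sesquilinear form of `Ω`,
times the standard volume form. -/
theorem IsTopCoord.ofMatrix_mul {p q : ℕ} {β : ExteriorAlgebra ℂ (Dual ℂ V)}
    {φ : ExteriorAlgebra ℂ (Dual ℂ V) →ₗ[ℂ] ℂ} (hφ : IsTopCoord (p + q) β φ)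
    {ι : Type*} [Fintype ι] {v : ι → ExteriorAlgebra ℂ (Dual ℂ V)}
    (hv : ∀ i, v i ∈ ⋀[ℂ]^p (Dual ℂ V)) (C : Matrix ι ι ℂ)
    {x : ExteriorAlgebra ℂ (Dual ℂ V)} (hx : x ∈ ⋀[ℂ]^q (Dual ℂ V)) :
    ofMatrix p v C * (sigma q • (hol x * conj (hol x))) =
      sigma (p + q) • hermForm φ v C x x • (hol β * conj (hol β) : Forms V) := by
  have hmem : ∀ i, v i * x ∈ ⋀[ℂ]^(p + q) (Dual ℂ V) := fun i => by
    rw [ExteriorAlgebra.exteriorPower, pow_add]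
    exact Submodule.mul_mem_mul (hv i) hx
  have h : ∀ i j, (C i j • (hol (v i) * conj (hol (v j)))) * (hol x * conj (hol x)) =
      (-1 : ℂ) ^ (p * q) • (C i j * (φ (v i * x) * starRingEnd ℂ (φ (v j * x)))) •
        (hol β * conj (hol β) : Forms V) := by
    intro i j
    rw [smul_mul_assoc, hol_mul_conj_hol_mul (hv j) hx]
    conv_lhs => rw [hφ _ (hmem i), hφ _ (hmem j)]
    rw [map_smul, map_smul, conj_smul, smul_mul_smul_comm, smul_smul, smul_smul, smul_smul]
    congr 1
    ring
  rw [ofMatrix, smul_mul_smul_comm, Finset.sum_mul]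
  simp only [Finset.sum_mul, h, ← Finset.smul_sum, ← Finset.sum_smul]
  rw [smul_smul, sigma_mul_sigma, hermForm_apply]

/-- The volume form of a basis of `V^*` does not vanish, as a basis of `V^*` and its conjugate
are together linearly independent over `ℂ`. -/
theorem hol_mul_conj_hol_ne_zero {n : ℕ} (b : Basis (Fin n) ℂ (Dual ℂ V)) :
    (hol (ExteriorAlgebra.ιMulti ℂ n b) * conj (hol (ExteriorAlgebra.ιMulti ℂ n b)) : Forms V) ≠
      0 := by
  rw [hol, ExteriorAlgebra.map_apply_ιMulti, conj, mapConj_ιMulti,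
    ExteriorAlgebra.ιMulti_mul_ιMulti]
  refine ExteriorAlgebra.ιMulti_ne_zero_of_linearIndependent ?_
  rw [Fintype.linearIndependent_iff]
  intro g hg
  rw [Fin.sum_univ_add] at hg
  simp only [Fin.append_left, Fin.append_right] at hg
  let f₁ : Dual ℂ V := ∑ i, g (Fin.castAdd n i) • b i
  let f₂ : Dual ℂ V := ∑ i, starRingEnd ℂ (g (Fin.natAdd n i)) • b i
  have hf : ∀ v, f₁ v + starRingEnd ℂ (f₂ v) = 0 := by
    intro v
    have := LinearMap.congr_fun hg v
    simpa [f₁, f₂, conjCovec, LinearMap.sum_apply] using this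
  have hf' : ∀ v, f₁ v = 0 ∧ f₂ v = 0 := by
    intro v
    have h1 := hf v
    have h2 := hf (Complex.I • v)
    simp only [map_smul, smul_eq_mul, map_mul, Complex.conj_I] at h2
    have h3 : f₁ v = 0 := by
      linear_combination h1 / 2 - Complex.I / 2 * h2 +
        (f₁ v - starRingEnd ℂ (f₂ v)) / 2 * Complex.I_sq
    refine ⟨h3, ?_⟩
    rw [h3, zero_add] at h1
    simpa using h1
  have h1 : ∀ i, g (Fin.castAdd n i) = 0 :=
    Fintype.linearIndependent_iff.mp b.linearIndependent _
      (LinearMap.ext fun v => (hf' v).1)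
  have h2 : ∀ i, starRingEnd ℂ (g (Fin.natAdd n i)) = 0 :=
    Fintype.linearIndependent_iff.mp b.linearIndependent _
      (LinearMap.ext fun v => (hf' v).2)
  intro i
  refine Fin.addCases h1 (fun i => ?_) i
  simpa using h2 i

open scoped ComplexOrder in
theorem IsTopCoord.pos_of_isStrictlyPositive {n : ℕ} {β : ExteriorAlgebra ℂ (Dual ℂ V)}
    {φ : ExteriorAlgebra ℂ (Dual ℂ V) →ₗ[ℂ] ℂ} (hφ : IsTopCoord n β φ)
    (hβ : β ∈ ⋀[ℂ]^n (Dual ℂ V)) (hvol : (hol β * conj (hol β) : Forms V) ≠ 0) {c : ℂ}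
    (h : IsStrictlyPositive n (sigma n • c • (hol β * conj (hol β) : Forms V))) : 0 < c := by
  obtain ⟨N, B, A, hA, hΘ⟩ := h
  set x : Fin N → ℂ := fun i => starRingEnd ℂ (φ (B i)) with hx
  have hβ0 : β ≠ 0 := by
    rintro rfl
    simp at hvol
  have hx0 : x ≠ 0 := by
    intro h0
    have hB : ∀ i, B i = 0 := by
      intro i
      have h1 : φ (B i) = 0 := by simpa [hx] using congrFun h0 i
      refine Subtype.ext ?_
      rw [hφ _ (B i).2, h1, zero_smul]
      rfl
    have h2 := B.sum_repr ⟨β, hβ⟩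
    simp only [hB, smul_zero, Finset.sum_const_zero] at h2
    exact hβ0 (congrArg Subtype.val h2).symm
  have hsum : ∑ i, ∑ j, A i j • (hol (B i : ExteriorAlgebra ℂ (Dual ℂ V)) *
      conj (hol (B j : ExteriorAlgebra ℂ (Dual ℂ V)))) =
        (star x ⬝ᵥ A *ᵥ x) • (hol β * conj (hol β) : Forms V) := by
    simp only [dotProduct, Matrix.mulVec, Finset.mul_sum, Finset.sum_smul]
    refine Finset.sum_congr rfl fun i _ => Finset.sum_congr rfl fun j _ => ?_
    conv_lhs => rw [hφ _ (B i).2, hφ _ (B j).2]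
    rw [map_smul, map_smul, conj_smul, smul_mul_smul_comm, smul_smul]
    congr 1
    simp only [hx, Pi.star_apply, RCLike.star_def, Complex.conj_conj]
    ring
  rw [hsum] at hΘ
  have hc : c = star x ⬝ᵥ A *ᵥ x :=
    smul_left_injective ℂ hvol (smul_right_injective _ (sigma_ne_zero n) hΘ)
  rw [hc]
  exact hA.dotProduct_mulVec_pos hx0

end

end PQForm

/-! ### Transverse forms, canonical forms and the positive index -/

namespace PQForm

open scoped Matrix

section

variable {V : Type*} [AddCommGroup V] [Module ℂ V]

theorem IsTopCoord.eq_zero {p q : ℕ} [FiniteDimensional ℂ V] (hn : finrank ℂ V = p + q)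
    {β : ExteriorAlgebra ℂ (Dual ℂ V)} {φ : ExteriorAlgebra ℂ (Dual ℂ V) →ₗ[ℂ] ℂ}
    (hφ : IsTopCoord (p + q) β φ) {N : ℕ} (η : Basis (Fin N) ℂ (⋀[ℂ]^p (Dual ℂ V)))
    {x : ExteriorAlgebra ℂ (Dual ℂ V)} (hx : x ∈ ⋀[ℂ]^q (Dual ℂ V))
    (h : ∀ j, φ (η j * x) = 0) : x = 0 := by
  refine ExteriorAlgebra.eq_zero_of_forall_mul_eq_zero (p := p)
    (by rw [Subspace.dual_finrank_eq, hn]) hx fun y hy => ?_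
  have hmem : y * x ∈ ⋀[ℂ]^(p + q) (Dual ℂ V) := by
    rw [ExteriorAlgebra.exteriorPower, pow_add]
    exact Submodule.mul_mem_mul hy hx
  have hy' : ∑ j, η.repr ⟨y, hy⟩ j • (η j : ExteriorAlgebra ℂ (Dual ℂ V)) = y := by
    have h := congrArg (Submodule.subtype _) (η.sum_repr ⟨y, hy⟩)
    rw [map_sum] at h
    exact h
  have h0 : φ (y * x) = 0 := by
    rw [← hy', Finset.sum_mul, map_sum]
    refine Finset.sum_eq_zero fun j _ => ?_
    rw [smul_mul_assoc, map_smul, h j, smul_zero]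
  rw [hφ _ hmem, h0, zero_smul]

open scoped ComplexOrder in
/-- On decomposable vectors the sesquilinear form of a transverse form is positive. -/
theorem IsTransverse.hermForm_pos {p q : ℕ} {Ω : Forms V} (hΩ : IsTransverse p q Ω)
    {β : ExteriorAlgebra ℂ (Dual ℂ V)} {φ : ExteriorAlgebra ℂ (Dual ℂ V) →ₗ[ℂ] ℂ}
    (hφ : IsTopCoord (p + q) β φ) (hβ : β ∈ ⋀[ℂ]^(p + q) (Dual ℂ V))
    (hvol : (hol β * conj (hol β) : Forms V) ≠ 0) {ι : Type*} [Fintype ι]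
    {v : ι → ExteriorAlgebra ℂ (Dual ℂ V)} (hv : ∀ i, v i ∈ ⋀[ℂ]^p (Dual ℂ V))
    {C : Matrix ι ι ℂ} (hC : Ω = ofMatrix p v C) {γ : Fin q → Dual ℂ V}
    (hγ : ExteriorAlgebra.ιMulti ℂ q γ ≠ 0) :
    0 < hermForm φ v C (ExteriorAlgebra.ιMulti ℂ q γ) (ExteriorAlgebra.ιMulti ℂ q γ) := by
  have h := hΩ.2 γ hγ
  rw [hC, hφ.ofMatrix_mul hv C (ExteriorAlgebra.ιMulti_mem q γ)] at h
  exact hφ.pos_of_isStrictlyPositive hβ hvol h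

/-- The coefficients of a sesquilinear form in the standard basis of `⋀^p V^*` are detected by
the decomposable vectors of the complementary basis. -/
theorem eq_zero_of_hermForm_eq_zero {p q : ℕ} (b : Basis (Fin (p + q)) ℂ (Dual ℂ V))
    {β : ExteriorAlgebra ℂ (Dual ℂ V)} {φ : ExteriorAlgebra ℂ (Dual ℂ V) →ₗ[ℂ] ℂ}
    (hφ : IsTopCoord (p + q) β φ)
    (C : Matrix (Set.powersetCard (Fin (p + q)) p) (Set.powersetCard (Fin (p + q)) p) ℂ)
    (h : ∀ γ δ : Fin q → Dual ℂ V, hermForm φ (ExteriorAlgebra.ιMulti_family ℂ p b) C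
      (ExteriorAlgebra.ιMulti ℂ q γ) (ExteriorAlgebra.ιMulti ℂ q δ) = 0) : C = 0 := by
  -- `c s` is the complement of `s`.
  let c : Set.powersetCard (Fin (p + q)) p ≃ Set.powersetCard (Fin (p + q)) q :=
    Set.powersetCard.compl (by simp [add_comm])
  have hne : ∀ s, φ (ExteriorAlgebra.ιMulti_family ℂ p b s *
      ExteriorAlgebra.ιMulti_family ℂ q b (c s)) ≠ 0 := by
    intro s h0
    refine ExteriorAlgebra.ιMulti_family_mul_compl_ne_zero b s (c s)
      (Finset.subset_compl_iff_disjoint_left.mp subset_rfl) ?_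
    have hmem : ExteriorAlgebra.ιMulti_family ℂ p b s *
        ExteriorAlgebra.ιMulti_family ℂ q b (c s) ∈ ⋀[ℂ]^(p + q) (Dual ℂ V) := by
      rw [ExteriorAlgebra.exteriorPower, pow_add]
      exact Submodule.mul_mem_mul (ExteriorAlgebra.ιMulti_mem p _) (ExteriorAlgebra.ιMulti_mem q _)
    rw [hφ _ hmem, h0, zero_smul]
  have hz : ∀ s t, t ≠ s → φ (ExteriorAlgebra.ιMulti_family ℂ p b t *
      ExteriorAlgebra.ιMulti_family ℂ q b (c s)) = 0 := by
    intro s t hts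
    rw [ExteriorAlgebra.ιMulti_family_mul_ιMulti_family_eq_zero rfl, map_zero]
    intro h0
    refine hts (h0.symm.trans ?_)
    exact c.symm_apply_apply s
  ext s t
  have hst : hermForm φ (ExteriorAlgebra.ιMulti_family ℂ p b) C
      (ExteriorAlgebra.ιMulti_family ℂ q b (c s)) (ExteriorAlgebra.ιMulti_family ℂ q b (c t)) = 0 :=
    h _ _
  rw [hermForm_apply, Finset.sum_eq_single s, Finset.sum_eq_single t] at hst
  · refine (mul_eq_zero.mp hst).resolve_right (mul_ne_zero (hne s) ?_)
    rw [Ne, map_eq_zero]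
    exact hne t
  · intro t' _ ht'
    rw [hz t t' ht', map_zero, mul_zero, mul_zero]
  · simp
  · intro s' _ hs'
    simp [hz s s' hs']
  · simp

/-- The coefficients of a transverse form are Hermitian: the anti-Hermitian part of its
sesquilinear form vanishes at `(τ, τ)` for `τ` decomposable, and polarization applies. -/
theorem IsTransverse.isHermitian {p q : ℕ} {Ω : Forms V} (hΩ : IsTransverse p q Ω)
    (b : Basis (Fin (p + q)) ℂ (Dual ℂ V))
    {φ : ExteriorAlgebra ℂ (Dual ℂ V) →ₗ[ℂ] ℂ}
    (hφ : IsTopCoord (p + q) (ExteriorAlgebra.ιMulti ℂ (p + q) b) φ)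
    {C : Matrix (Set.powersetCard (Fin (p + q)) p) (Set.powersetCard (Fin (p + q)) p) ℂ}
    (hC : Ω = ofMatrix p (ExteriorAlgebra.ιMulti_family ℂ p b) C) : C.IsHermitian := by
  have hsub : ∀ x y, hermForm φ (ExteriorAlgebra.ιMulti_family ℂ p b) (Cᴴ - C) x y =
      starRingEnd ℂ (hermForm φ (ExteriorAlgebra.ιMulti_family ℂ p b) C y x) -
        hermForm φ (ExteriorAlgebra.ιMulti_family ℂ p b) C x y := by
    intro x y
    rw [← hermForm_conjTranspose]
    simp only [hermForm_apply, Matrix.sub_apply, sub_mul, Finset.sum_sub_distrib]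
  refine sub_eq_zero.mp (eq_zero_of_hermForm_eq_zero (q := q) b hφ (Cᴴ - C) ?_)
  refine LinearMap.eq_zero_of_forall_multilinear_self_eq_zero
    (ExteriorAlgebra.ιMulti ℂ q).toMultilinearMap _ fun γ => ?_
  by_cases hγ : ExteriorAlgebra.ιMulti ℂ q γ = 0
  · simp [hγ]
  have hpos := hΩ.hermForm_pos hφ (ExteriorAlgebra.ιMulti_mem _ _) (hol_mul_conj_hol_ne_zero b)
    (fun s => ExteriorAlgebra.ιMulti_mem p _) hC hγ
  have him := (Complex.pos_iff.mp hpos).2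
  refine (hsub _ _).trans (sub_eq_zero.mpr ?_)
  exact Complex.conj_eq_iff_im.mpr him.symm

end

section Hermitian

variable {V : Type*} [NormedAddCommGroup V] [InnerProductSpace ℂ V] [FiniteDimensional ℂ V]

variable (V) in
/-- `formInner` as a sesquilinear map. -/
noncomputable def formInnerₛₗ (p : ℕ) :
    ⋀[ℂ]^p (Dual ℂ V) →ₗ[ℂ] ⋀[ℂ]^p (Dual ℂ V) →ₛₗ[starRingEnd ℂ] ℂ :=
  LinearMap.mk₂'ₛₗ (RingHom.id ℂ) (starRingEnd ℂ) (formInner p)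
    (fun x x' y => by simp [formInner])
    (fun c x y => by simp [formInner])
    (fun x y y' => by
      rw [formInner, formInner, formInner, ← map_add]
      congr 1
      ext
      simp)
    (fun c x y => by
      rw [formInner, formInner, ← map_smul]
      congr 1
      ext
      simp [mapConj_smul])

theorem formInnerₛₗ_apply (p : ℕ) (x y : ⋀[ℂ]^p (Dual ℂ V)) :
    formInnerₛₗ V p x y = formInner p x y := rfl

theorem sharp_dualBasis {n : ℕ} (u : OrthonormalBasis (Fin n) ℂ V) (i : Fin n) :
    sharp V (u.toBasis.dualBasis i) = u i := by
  refine ext_inner_right ℂ fun v => ?_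
  rw [inner_sharp, Basis.coe_dualBasis, Basis.coord_apply, OrthonormalBasis.coe_toBasis_repr_apply,
    OrthonormalBasis.repr_apply_apply]

theorem formInner_ιMulti_family {n p : ℕ} (u : OrthonormalBasis (Fin n) ℂ V)
    (s t : Set.powersetCard (Fin n) p) :
    formInner p (exteriorPower.ιMulti_family ℂ p u.toBasis.dualBasis s)
      (exteriorPower.ιMulti_family ℂ p u.toBasis.dualBasis t) = if s = t then 1 else 0 := by
  have h : formInner p (exteriorPower.ιMulti_family ℂ p u.toBasis.dualBasis s)
      (exteriorPower.ιMulti_family ℂ p u.toBasis.dualBasis t) =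
        exteriorPower.ιMultiDual ℂ p u.toBasis.dualBasis t
          (exteriorPower.ιMulti_family ℂ p u.toBasis.dualBasis s) := by
    rw [exteriorPower.ιMulti_family, exteriorPower.ιMulti_family, formInner_ιMulti,
      exteriorPower.ιMultiDual_apply_ιMulti]
    congr 1
    ext i j
    simp only [Matrix.of_apply, Function.comp_apply, sharp_dualBasis, Basis.coord_apply,
      Basis.repr_self, orthonormal_iff_ite.mp u.orthonormal, Finsupp.single_apply]
  rw [h]
  split_ifs with hst
  · rw [hst, exteriorPower.ιMultiDual_apply_diag]
  · exact exteriorPower.ιMultiDual_apply_nondiag ℂ p _ t s fun h => hst h.symm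

/-- The spectral theorem provides canonical forms. -/
theorem exists_isCanonicalForm {n p : ℕ} (u : OrthonormalBasis (Fin n) ℂ V)
    {C : Matrix (Set.powersetCard (Fin n) p) (Set.powersetCard (Fin n) p) ℂ}
    (hC : C.IsHermitian) :
    ∃ (N : ℕ) (l : Fin N → ℝ) (η : Basis (Fin N) ℂ (⋀[ℂ]^p (Dual ℂ V))), IsCanonicalForm p
      (ofMatrix p (ExteriorAlgebra.ιMulti_family ℂ p u.toBasis.dualBasis) C) l η := by
  set e := exteriorPower.ιMulti_family ℂ p u.toBasis.dualBasis with he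
  let U : Matrix (Set.powersetCard (Fin n) p) (Set.powersetCard (Fin n) p) ℂ :=
    hC.eigenvectorUnitary
  -- The factor `s` turns the orthonormal eigenvectors into vectors of square norm `2 ^ p`.
  let s : ℂ := ((Real.sqrt 2 ^ p : ℝ) : ℂ)
  have hs : s * starRingEnd ℂ s = 2 ^ p := by
    rw [Complex.conj_ofReal, ← Complex.ofReal_mul, ← mul_pow, Real.mul_self_sqrt zero_le_two]
    simp
  let W : Matrix (Set.powersetCard (Fin n) p) (Set.powersetCard (Fin n) p) ℂ := s • U
  let η : Set.powersetCard (Fin n) p → ⋀[ℂ]^p (Dual ℂ V) := fun a => ∑ i, W i a • e i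
  have hinner : ∀ a b, formInnerₛₗ V p (η a) (η b) = if a = b then 2 ^ p else 0 := by
    intro a b
    have h1 : formInnerₛₗ V p (η a) (η b) = (Wᴴ * W) b a := by
      simp only [η, map_sum, LinearMap.sum_apply, map_smul, LinearMap.smul_apply,
        LinearMap.map_smulₛₗ, formInnerₛₗ_apply, he, formInner_ιMulti_family, smul_eq_mul,
        mul_ite, mul_one, mul_zero, Finset.sum_ite_eq', Finset.mem_univ, if_true,
        Matrix.mul_apply, Matrix.conjTranspose_apply, starRingEnd_apply]
    have h2 : Wᴴ * W = (2 ^ p : ℂ) • (1 : Matrix _ _ ℂ) := by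
      have hUU : Uᴴ * U = 1 := Unitary.coe_star_mul_self hC.eigenvectorUnitary
      rw [Matrix.conjTranspose_smul, Matrix.smul_mul, Matrix.mul_smul, smul_smul, hUU, ← hs,
        mul_comm]
      rfl
    rw [h1, h2, Matrix.smul_apply, Matrix.one_apply]
    simp [eq_comm]
  have hli : LinearIndependent ℂ η := by
    rw [Fintype.linearIndependent_iff]
    intro g hg i
    have h := congrArg (fun x => formInnerₛₗ V p x (η i)) hg
    simpa [hinner] using h
  have hcard : Fintype.card (Set.powersetCard (Fin n) p) = finrank ℂ (⋀[ℂ]^p (Dual ℂ V)) :=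
    (finrank_eq_card_basis (u.toBasis.dualBasis.exteriorPower p)).symm
  let B : Basis _ ℂ (⋀[ℂ]^p (Dual ℂ V)) :=
    Basis.mk hli (hli.span_eq_top_of_card_eq_finrank' hcard).ge
  have hB : ∀ a, B a = η a := fun a => Basis.mk_apply _ _ a
  let E := Fintype.equivFin (Set.powersetCard (Fin n) p)
  let μ : Set.powersetCard (Fin n) p → ℝ := fun a => hC.eigenvalues a / 2 ^ p
  refine ⟨_, fun j => μ (E.symm j), B.reindex E, fun i j hij => ?_, fun j => ?_, ?_⟩
  · rw [Basis.reindex_apply, Basis.reindex_apply, hB, hB, ← formInnerₛₗ_apply, hinner,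
      if_neg fun h => hij (E.symm.injective h)]
  · rw [Basis.reindex_apply, hB, ← formInnerₛₗ_apply, hinner, if_pos rfl]
  · have hspec : C = W * Matrix.diagonal (fun a => (μ a : ℂ)) * Wᴴ := by
      have h := hC.spectral_theorem
      rw [Unitary.conjStarAlgAut_apply] at h
      have hd : Matrix.diagonal (RCLike.ofReal ∘ hC.eigenvalues : _ → ℂ) =
          (2 ^ p : ℂ) • Matrix.diagonal (fun a => (μ a : ℂ)) := by
        rw [← Matrix.diagonal_smul]
        congr 1
        ext a
        simp only [Function.comp_apply, Pi.smul_apply, smul_eq_mul, μ, Complex.ofReal_div,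
          Complex.ofReal_pow, Complex.ofReal_ofNat]
        rw [mul_div_cancel₀ _ (pow_ne_zero p two_ne_zero)]
        rfl
      rw [hd] at h
      conv_lhs => rw [h]
      simp only [W, Matrix.conjTranspose_smul, Matrix.smul_mul, Matrix.mul_smul, smul_smul]
      rw [← hs, mul_comm]
      rfl
    conv_lhs => rw [hspec]
    rw [← ofMatrix_sum_smul, ofMatrix_diagonal]
    congr 1
    rw [← E.symm.sum_comp]
    refine Finset.sum_congr rfl fun j _ => ?_
    rw [Basis.reindex_apply, hB]
    have : (η (E.symm j) : ExteriorAlgebra ℂ (Dual ℂ V)) =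
        ∑ i, W i (E.symm j) • ExteriorAlgebra.ιMulti_family ℂ p u.toBasis.dualBasis i := by
      simp [η, he]
    rw [this]

theorem IsCanonicalForm.eq_ofMatrix {p N : ℕ} {Ω : Forms V} {l : Fin N → ℝ}
    {η : Basis (Fin N) ℂ (⋀[ℂ]^p (Dual ℂ V))} (h : IsCanonicalForm p Ω l η) :
    Ω = ofMatrix p (fun j => (η j : ExteriorAlgebra ℂ (Dual ℂ V)))
      (Matrix.diagonal fun j => (l j : ℂ)) := by
  rw [ofMatrix_diagonal]
  exact h.2.2

/-- Half of Sylvester's law of inertia: otherwise a dimension count gives a nonzero vector on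
which the Hermitian form would be both positive and nonpositive. -/
theorem IsCanonicalForm.numPos_le {p q : ℕ} (hn : finrank ℂ V = p + q) {Ω : Forms V} {N N' : ℕ}
    {l : Fin N → ℝ} {η : Basis (Fin N) ℂ (⋀[ℂ]^p (Dual ℂ V))} (h : IsCanonicalForm p Ω l η)
    {l' : Fin N' → ℝ} {η' : Basis (Fin N') ℂ (⋀[ℂ]^p (Dual ℂ V))}
    (h' : IsCanonicalForm p Ω l' η') {β : ExteriorAlgebra ℂ (Dual ℂ V)}
    {φ : ExteriorAlgebra ℂ (Dual ℂ V) →ₗ[ℂ] ℂ} (hφ : IsTopCoord (p + q) β φ)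
    (hvol : (hol β * conj (hol β) : Forms V) ≠ 0) : numPos l ≤ numPos l' := by
  classical
  by_contra! hlt
  have hN : N = finrank ℂ (⋀[ℂ]^q (Dual ℂ V)) := by
    rw [← Fintype.card_fin N, ← finrank_eq_card_basis η, exteriorPower.finrank_eq,
      exteriorPower.finrank_eq, Subspace.dual_finrank_eq, hn, Nat.choose_symm_add]
  let F (y : ExteriorAlgebra ℂ (Dual ℂ V)) : ⋀[ℂ]^q (Dual ℂ V) →ₗ[ℂ] ℂ :=
    φ ∘ₗ LinearMap.mulLeft ℂ y ∘ₗ Submodule.subtype _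
  -- There are fewer linear conditions in `T` than the dimension `N` of `⋀^q V^*`.
  let T : ⋀[ℂ]^q (Dual ℂ V) →ₗ[ℂ] ({j // ¬ 0 < l j} → ℂ) × ({j // 0 < l' j} → ℂ) :=
    (LinearMap.pi fun j : {j // ¬ 0 < l j} => F (η j)).prod
      (LinearMap.pi fun j : {j // 0 < l' j} => F (η' j))
  have hker : LinearMap.ker T ≠ ⊥ := by
    refine LinearMap.ker_ne_bot_of_finrank_lt ?_
    rw [finrank_prod, finrank_pi, finrank_pi, ← hN, Fintype.card_subtype_compl, Fintype.card_fin]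
    rw [numPos, numPos, Nat.card_eq_fintype_card, Nat.card_eq_fintype_card] at hlt
    have : Fintype.card {j // 0 < l j} ≤ N := by
      simpa using Fintype.card_subtype_le (fun j => 0 < l j)
    omega
  obtain ⟨x, hxT, hx0⟩ := (Submodule.ne_bot_iff _).mp hker
  have hT := LinearMap.mem_ker.mp hxT
  have h1 : ∀ j, ¬ 0 < l j → φ (η j * x) = 0 := fun j hj =>
    congrFun (congrArg Prod.fst hT) ⟨j, hj⟩
  have h2 : ∀ j, 0 < l' j → φ (η' j * x) = 0 := fun j hj =>
    congrFun (congrArg Prod.snd hT) ⟨j, hj⟩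
  have e1 := hφ.ofMatrix_mul (fun j => (η j).2) (Matrix.diagonal fun j => (l j : ℂ)) x.2
  have e2 := hφ.ofMatrix_mul (fun j => (η' j).2) (Matrix.diagonal fun j => (l' j : ℂ)) x.2
  rw [← h.eq_ofMatrix, hermForm_diagonal] at e1
  rw [← h'.eq_ofMatrix, hermForm_diagonal, e1] at e2
  have heq : ∑ j, l j * Complex.normSq (φ (η j * x)) =
      ∑ j, l' j * Complex.normSq (φ (η' j * x)) := by
    exact_mod_cast smul_left_injective ℂ hvol (smul_right_injective _ (sigma_ne_zero _) e2)
  have hnonneg : ∀ j, 0 ≤ l j * Complex.normSq (φ (η j * x)) := by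
    intro j
    by_cases hj : 0 < l j
    · exact mul_nonneg hj.le (Complex.normSq_nonneg _)
    · simp [h1 j hj]
  have hnonpos : ∑ j, l' j * Complex.normSq (φ (η' j * x)) ≤ 0 := by
    refine Finset.sum_nonpos fun j _ => ?_
    by_cases hj : 0 < l' j
    · simp [h2 j hj]
    · exact mul_nonpos_of_nonpos_of_nonneg (not_lt.mp hj) (Complex.normSq_nonneg _)
  have hzero := (Finset.sum_eq_zero_iff_of_nonneg fun j _ => hnonneg j).mp
    (le_antisymm (heq.le.trans hnonpos) (Finset.sum_nonneg fun j _ => hnonneg j))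
  refine hx0 (Subtype.ext (hφ.eq_zero hn η x.2 fun j => ?_))
  by_cases hj : 0 < l j
  · exact Complex.normSq_eq_zero.mp ((mul_eq_zero.mp (hzero j (Finset.mem_univ j))).resolve_left
      hj.ne')
  · exact h1 j hj

/-- If at most `pq` coefficients were positive, a nonzero decomposable vector would be
annihilated by the corresponding linear forms, and the Hermitian form would not be positive on
it. -/
theorem IsTransverse.lt_numPos {p q : ℕ} (hn : finrank ℂ V = p + q) {Ω : Forms V}
    (hΩ : IsTransverse p q Ω) {N : ℕ} {l : Fin N → ℝ}
    {η : Basis (Fin N) ℂ (⋀[ℂ]^p (Dual ℂ V))} (h : IsCanonicalForm p Ω l η)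
    {β : ExteriorAlgebra ℂ (Dual ℂ V)} {φ : ExteriorAlgebra ℂ (Dual ℂ V) →ₗ[ℂ] ℂ}
    (hφ : IsTopCoord (p + q) β φ) (hβ : β ∈ ⋀[ℂ]^(p + q) (Dual ℂ V))
    (hvol : (hol β * conj (hol β) : Forms V) ≠ 0) : p * q < numPos l := by
  classical
  by_contra! hle
  let E : {j // 0 < l j} ≃ Fin (numPos l) := Finite.equivFin _
  obtain ⟨γ, hγ, hL⟩ := exists_ιMulti_ne_zero_forall_eq_zero (E := Dual ℂ V)
    (by rw [Subspace.dual_finrank_eq, hn]) (hle.trans_eq (mul_comm p q))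
    (fun i => (φ ∘ₗ LinearMap.mulLeft ℂ
      (η (E.symm i) : ExteriorAlgebra ℂ (Dual ℂ V))).compAlternatingMap (ExteriorAlgebra.ιMulti ℂ q))
  have hpos := hΩ.hermForm_pos hφ hβ hvol (fun j => (η j).2) h.eq_ofMatrix hγ
  rw [hermForm_diagonal, Complex.zero_lt_real] at hpos
  refine hpos.not_ge (Finset.sum_nonpos fun j _ => ?_)
  by_cases hj : 0 < l j
  · have h0 : φ (η j * ExteriorAlgebra.ιMulti ℂ q γ) = 0 := by
      simpa using hL (E ⟨j, hj⟩)
    simp [h0]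
  · exact mul_nonpos_of_nonpos_of_nonneg (not_lt.mp hj) (Complex.normSq_nonneg _)

end Hermitian

end PQForm

theorem proposition4 {V : Type*} [NormedAddCommGroup V] [InnerProductSpace ℂ V]
    [FiniteDimensional ℂ V] (n p q : ℕ) (hn : Module.finrank ℂ V = n) (hpq : p + q = n)
    (N : ℕ) (hN : N = n.choose q) (k : ℤ) (hk : k = ((N : ℤ) - 1) - (p : ℤ) * (q : ℤ))
    (Ω : PQForm.Forms V) (hΩ : PQForm.IsTransverse p q Ω) :
    PQForm.conj Ω = Ω ∧ ∃ m : ℕ,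
      (∀ m' : ℕ, PQForm.HasPositiveIndex p Ω m' ↔ m' = m) ∧ (N : ℤ) - k ≤ (m : ℤ) := by
  subst hpq
  let u : OrthonormalBasis (Fin (p + q)) ℂ V :=
    (stdOrthonormalBasis ℂ V).reindex (finCongr hn)
  let b := u.toBasis.dualBasis
  obtain ⟨φ, hφ⟩ := ExteriorAlgebra.exists_eq_smul_ιMulti
    (by rw [Subspace.dual_finrank_eq, hn]) b
  have hφ : PQForm.IsTopCoord (p + q) _ φ := hφ
  have hβ := ExteriorAlgebra.ιMulti_mem (R := ℂ) (p + q) b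
  have hvol := PQForm.hol_mul_conj_hol_ne_zero b
  obtain ⟨C, hC⟩ := PQForm.exists_eq_ofMatrix (b.exteriorPower p) hΩ.1
  have hC : Ω = PQForm.ofMatrix p (ExteriorAlgebra.ιMulti_family ℂ p b) C := by
    simpa using hC
  have hherm := hΩ.isHermitian b hφ hC
  refine ⟨?_, ?_⟩
  · rw [hC, PQForm.conj_ofMatrix fun s => ExteriorAlgebra.ιMulti_mem p _, hherm.eq]
  obtain ⟨M, l, η, hcan⟩ := PQForm.exists_isCanonicalForm (p := p) u hherm
  rw [← hC] at hcan
  refine ⟨PQForm.numPos l, fun m' => ⟨?_, ?_⟩, ?_⟩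
  · rintro ⟨M', l', η', hcan', rfl⟩
    exact le_antisymm (hcan'.numPos_le hn hcan hφ hvol) (hcan.numPos_le hn hcan' hφ hvol)
  · rintro rfl
    exact ⟨M, l, η, hcan, rfl⟩
  · have h : ((p * q : ℕ) : ℤ) < PQForm.numPos l :=
      Nat.cast_lt.mpr (hΩ.lt_numPos hn hcan hφ hβ hvol)
    rw [Nat.cast_mul] at h
    omega
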